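/- Let $G=(V,E)$ be a finite simple undirected graph. A triangle of $G$ is a cycle of length $3$; a square of $G$ is an induced cycle of length $4$. The triangle complex $X_{\triangle}(G)$ is the two-dimensional cell complex whose $0$-cells are the vertices of $G$, whose $1$-cells are the edges of $G$, and which has one solid triangle as a $2$-cell attached along each triangle of $G$. The triangle-square complex $X_{\triangle\square}(G)$ is obtained from $X_{\triangle}(G)$ by attaching in addition one solid square along each square of $G$. For a labeling $L:V\to\{0,1,2\}$ consider the rules (MG$\triangle$) for every triangle $uvw$ of $G$, $\{L(u),L(v),L(w)\}\neq\{0,1,2\}$; (MG$\square$) for every square $uvwx$ of $G$ such that $\{L(u),L(v),L(w),L(x)\}=\{0,1,2\}$, any two vertices of $uvwx$ with the same label are non-adjacent. Let $\vec{G}_L$ be the directed graph with vertex set $V$ that has an arc from $v$ to $u$ if and only if $vu\in E$ and $L(v)\equiv L(u)+1 \pmod 3$. Then: (1) if $X_{\triangle}(G)$ is simply connected and $L$ satisfies (MG$\triangle$), then $\vec{G}_L$ is acyclic, i.e. it has no directed cycle; (2) if $X_{\triangle\square}(G)$ is simply connected and $L$ satisfies (MG$\triangle$) and (MG$\square$),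 then $\vec{G}_L$ is acyclic. -/

import Mathlib

namespace TriSq

variable {V : Type*}

/-- `u, v, w` are the vertices of a triangle (cycle of length three) of `G`. -/
def IsTriangle (G : SimpleGraph V) (u v w : V) : Prop :=
  G.Adj u v ∧ G.Adj v w ∧ G.Adj w u

/-- `u, v, w, x`, in this cyclic order, are the vertices of a square of `G`, that is, of an
induced cycle of length four. -/
def IsSquare (G : SimpleGraph V) (u v w x : V) : Prop :=
  G.Adj u v ∧ G.Adj v w ∧ G.Adj w x ∧ G.Adj x u ∧
    u ≠ w ∧ v ≠ x ∧ ¬ G.Adj u w ∧ ¬ G.Adj v x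

/-! ### The triangle complex -/

/-- The cells of the triangle complex, given by their vertex sets: single vertices, edges and
triangles, i.e. the nonempty cliques with at most three vertices. -/
def Simplex (G : SimpleGraph V) : Type _ :=
  {s : Finset V // s.Nonempty ∧ s.card ≤ 3 ∧ G.IsClique (s : Set V)}

/-- The closed solid simplex with vertex set `s`, in barycentric coordinates. -/
def solidSimplex (s : Finset V) : Set (V → ℝ) :=
  {y | (∀ v, 0 ≤ y v) ∧ (∀ v, v ∉ s → y v = 0) ∧ ∑ v ∈ s, y v = 1}

/-- The disjoint union of all vertices, closed edges and closed solid triangles of `G`. -/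
abbrev SimplexPoint (G : SimpleGraph V) : Type _ :=
  Σ s : Simplex G, solidSimplex s.1

/-- The triangle complex of `G`: the disjoint union of the vertices, edges and solid triangles
of `G`, glued along their common faces (points of two cells are identified when they have the
same barycentric coordinates), with the quotient topology. -/
def TriangleComplex (G : SimpleGraph V) : Type _ :=
  Quot fun p q : SimplexPoint G => (p.2 : V → ℝ) = (q.2 : V → ℝ)

instance (G : SimpleGraph V) : TopologicalSpace (TriangleComplex G) :=
  inferInstanceAs (TopologicalSpace (Quot _))

/-! ### The triangle-square complex -/

open Classical in
/-- The edge `uv` as a cell of the triangle complex. -/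
noncomputable def edgeCell {G : SimpleGraph V} {u v : V} (h : G.Adj u v) : Simplex G :=
  ⟨{u, v}, by simp, Finset.card_le_two.trans (by norm_num), by
    simpa [SimpleGraph.isClique_pair] using fun _ => h⟩

open Classical in
/-- The barycentric coordinates of the point `(1 - t) u + t v`. -/
noncomputable def segmentCoord (u v : V) (t : ℝ) : V → ℝ :=
  (1 - t) • Pi.single u 1 + t • Pi.single v 1

theorem segmentCoord_mem {G : SimpleGraph V} {u v : V} (h : G.Adj u v) (t : unitInterval) :
    segmentCoord u v t ∈ solidSimplex (edgeCell h).1 := by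
  classical
  have h0 := t.2.1
  have h1 := t.2.2
  have huv := h.ne
  refine ⟨fun a => ?_, fun a ha => ?_, ?_⟩
  · simp only [segmentCoord, Pi.add_apply, Pi.smul_apply, smul_eq_mul, Pi.single_apply]
    split_ifs <;> simp <;> linarith
  · have hau : a ≠ u := by rintro rfl; simp [edgeCell] at ha
    have hav : a ≠ v := by rintro rfl; simp [edgeCell] at ha
    simp [segmentCoord, hau, hav]
  · have : (edgeCell h).1 = {u, v} := by ext; simp [edgeCell]
    rw [this, Finset.sum_pair huv]
    simp [segmentCoord, huv, huv.symm]

/-- The point of the edge `uv` of the triangle complex at parameter `t`, going from `u` (`t = 0`)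
to `v` (`t = 1`). -/
noncomputable def edgePoint {G : SimpleGraph V} {u v : V} (h : G.Adj u v) (t : unitInterval) :
    TriangleComplex G :=
  Quot.mk _ ⟨edgeCell h, ⟨segmentCoord u v t, segmentCoord_mem h t⟩⟩

/-- The squares of `G`, given by their vertex sets. (Since a square is an induced cycle, it is
determined by its vertex set.) -/
def Square (G : SimpleGraph V) : Type _ :=
  {S : Set V // ∃ q : Fin 4 → V, IsSquare G (q 0) (q 1) (q 2) (q 3) ∧ S = Set.range q}

/-- An enumeration of the corners of a square in cyclic order. The choice of the enumeration only
changes the parametrization of the solid square by a symmetry of `[0,1]²`. -/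
noncomputable def Square.corner {G : SimpleGraph V} (S : Square G) : Fin 4 → V :=
  S.2.choose

theorem Square.isSquare {G : SimpleGraph V} (S : Square G) :
    IsSquare G (S.corner 0) (S.corner 1) (S.corner 2) (S.corner 3) :=
  S.2.choose_spec.1

/-- The disjoint union of the triangle complex and of one solid square `[0,1]²` for every square
of `G`. -/
abbrev TriSqPoint (G : SimpleGraph V) : Type _ :=
  TriangleComplex G ⊕ (Σ _ : Square G, unitInterval × unitInterval)

/-- The gluing of the boundary of each solid square `[0,1]²` to the corresponding cycle of `G`:
the points `(0,0)`, `(1,0)`, `(1,1)`, `(0,1)` are attached to the corners `0`, `1`, `2`, `3`, and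
each of the four sides is attached to the corresponding edge. -/
inductive SquareGlue (G : SimpleGraph V) : TriSqPoint G → TriSqPoint G → Prop
  | bottom (S : Square G) (t : unitInterval) :
      SquareGlue G (.inr ⟨S, (t, 0)⟩) (.inl (edgePoint S.isSquare.1 t))
  | right (S : Square G) (t : unitInterval) :
      SquareGlue G (.inr ⟨S, (1, t)⟩) (.inl (edgePoint S.isSquare.2.1 t))
  | top (S : Square G) (t : unitInterval) :
      SquareGlue G (.inr ⟨S, (t, 1)⟩) (.inl (edgePoint S.isSquare.2.2.1.symm t))
  | left (S : Square G) (t : unitInterval) :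
      SquareGlue G (.inr ⟨S, (0, t)⟩) (.inl (edgePoint S.isSquare.2.2.2.1.symm t))

/-- The triangle-square complex of `G`: a solid square is attached to the triangle complex along
each square of `G`. -/
def TriangleSquareComplex (G : SimpleGraph V) : Type _ :=
  Quot (SquareGlue G)

instance (G : SimpleGraph V) : TopologicalSpace (TriangleSquareComplex G) :=
  inferInstanceAs (TopologicalSpace (Quot _))

/-! ### Labelings -/

/-- The rule (MG△). -/
def MGTriangle (G : SimpleGraph V) (L : V → Fin 3) : Prop :=
  ∀ u v w, IsTriangle G u v w → ({L u, L v, L w} : Set (Fin 3)) ≠ {0, 1, 2}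

/-- The rule (MG□). -/
def MGSquare (G : SimpleGraph V) (L : V → Fin 3) : Prop :=
  ∀ u v w x, IsSquare G u v w x → ({L u, L v, L w, L x} : Set (Fin 3)) = {0, 1, 2} →
    ∀ a ∈ ({u, v, w, x} : Set V), ∀ b ∈ ({u, v, w, x} : Set V), L a = L b → ¬ G.Adj a b

/-- The directed graph `G_L`: there is an arc from `v` to `u` iff `vu` is an edge of `G` and
`L v = L u + 1` modulo `3` (addition of `Fin 3` is addition modulo `3`). -/
def labelDigraph (G : SimpleGraph V) (L : V → Fin 3) : Digraph V where
  Adj v u := G.Adj v u ∧ L v = L u + 1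

/-- A directed graph is acyclic if no directed walk of positive length returns to its start
(equivalently, if it has no directed cycle). -/
def IsAcyclic (D : Digraph V) : Prop :=
  ∀ v, ¬ Relation.TransGen D.Adj v v

end TriSq

/-!
The labels modulo `3` are viewed as three points of the circle `ℝ / 3ℤ`, and the labeling extends
to a continuous map from the complex to this circle. On a simplex this works because, by (MG△),
some label is missing, so the labels of the vertices lift to integers that pairwise differ by at
most one; the affine interpolation of such a lift is unique up to a multiple of `3`
(`coe_interpolation_eq`), so the interpolations on different cells agree on common faces. On a
square the rule (MG□), together with (MG△), excludes that the labels wind around the circle along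
the boundary (`exists_squareLift`), so the bilinear interpolation of an integer lift of the labels
extends the map over the solid square.

An arc from `v` to `u` becomes a path in the complex whose image in the circle lifts to a path in
`ℝ` of displacement `-1`. A directed cycle thus gives a loop whose image lifts to a path with
distinct endpoints. In a simply connected complex every loop is nullhomotopic, so by the homotopy
lifting property of the covering `ℝ → ℝ / 3ℤ` its image lifts to closed paths only
(`isAcyclic_of_simplyConnectedSpace`), a contradiction.
-/

namespace TriSq

variable {V : Type*} {G : SimpleGraph V} {L : V → Fin 3}

/-! ### The covering argument -/

/-- If a simply connected space `X` maps to `ℝ / 3ℤ`, and every arc of a directed graph gives a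
path in `X` along which the value in `ℝ / 3ℤ` decreases at unit speed, then the directed graph is
acyclic. -/
theorem isAcyclic_of_simplyConnectedSpace {X : Type*} [TopologicalSpace X]
    [SimplyConnectedSpace X] (D : Digraph V) (ι : V → X) (φ : C(X, AddCircle (3 : ℝ)))
    (arc : ∀ v u, D.Adj v u → ∃ γ : Path (ι v) (ι u),
      ∀ t, φ (γ t) = φ (ι v) - ((t : ℝ) : AddCircle (3 : ℝ))) :
    IsAcyclic D := by
  have key : ∀ v u, Relation.TransGen D.Adj v u → ∃ γ : Path (ι v) (ι u), ∃ a b : ℝ, b < a ∧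
      ∃ Γ : Path a b, ∀ t, φ (γ t) = (Γ t : AddCircle (3 : ℝ)) := by
    have descend : ∀ b : ℝ, ∃ Γ : Path b (b - 1), ∀ t, Γ t = b - t := fun b =>
      ⟨⟨⟨fun t => b - t, by fun_prop⟩, by simp, by simp⟩, fun _ => rfl⟩
    intro v u h
    induction h with
    | single h =>
      obtain ⟨γ, hγ⟩ := arc _ _ h
      obtain ⟨a, ha⟩ := QuotientAddGroup.mk_surjective (φ (ι v))
      obtain ⟨Γ, hΓ⟩ := descend a
      refine ⟨γ, a, a - 1, by linarith, Γ, fun t => ?_⟩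
      rw [hγ, hΓ, ← ha, AddCircle.coe_sub]
    | @tail w _ _ h ih =>
      obtain ⟨γ, a, b, hab, Γ, hΓ⟩ := ih
      obtain ⟨γ', hγ'⟩ := arc _ _ h
      obtain ⟨Γ', hΓ'⟩ := descend b
      refine ⟨γ.trans γ', a, b - 1, by linarith, Γ.trans Γ', fun t => ?_⟩
      have hb : φ (ι w) = (b : AddCircle (3 : ℝ)) := by simpa using hΓ 1
      rw [Path.trans_apply, Path.trans_apply]
      split_ifs
      · exact hΓ _
      · rw [hγ', hb, hΓ']
        exact (AddCircle.coe_sub (3 : ℝ) _ _).symm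
  intro v hv
  obtain ⟨γ, a, b, hab, Γ, hΓ⟩ := key v v hv
  have cov := AddCircle.isCoveringMap_coe (3 : ℝ)
  have ha : φ (ι v) = (a : AddCircle (3 : ℝ)) := by simpa using hΓ 0
  have hom : (φ.comp (γ : C(unitInterval, X))).HomotopicRel
      (φ.comp (Path.refl (ι v) : C(unitInterval, X))) {0, 1} :=
    (SimplyConnectedSpace.paths_homotopic γ (Path.refl (ι v))).elim
      fun F => ⟨F.compContinuousMap φ⟩
  have h0 : (φ.comp (γ : C(unitInterval, X))) 0 = (a : AddCircle (3 : ℝ)) := by simpa using ha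
  have h1 : (φ.comp (Path.refl (ι v) : C(unitInterval, X))) 0 = (a : AddCircle (3 : ℝ)) := by
    simpa using ha
  have e := cov.liftPath_apply_one_eq_of_homotopicRel hom a h0 h1
  have e0 := (cov.eq_liftPath_iff' h0 (Γ := (Γ : C(unitInterval, ℝ)))).2
    ⟨funext fun t => (hΓ t).symm, by simp⟩
  have e1 := (cov.eq_liftPath_iff' h1 (Γ := .const _ a)).2
    ⟨funext fun t => by simpa using ha.symm, by simp⟩
  rw [← e0, ← e1] at e
  have : b = a := by simpa using e
  exact hab.ne this

/-! ### Integer lifts of the labels on a simplex -/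

/-- An integer-valued lift of the labels modulo `3` on the vertex set `s`, any two values of which
differ by at most one. -/
def IsLabelLift (L : V → Fin 3) (s : Finset V) (l : V → ℤ) : Prop :=
  (∀ v ∈ s, 3 ∣ l v - (L v : ℕ)) ∧ ∀ u ∈ s, ∀ v ∈ s, l u - l v ≤ 1

/-- The affine interpolation of the vertex values `l`, in barycentric coordinates on `s`. -/
def interpolation (s : Finset V) (l : V → ℤ) (y : V → ℝ) : ℝ :=
  ∑ v ∈ s, y v * l v

theorem continuous_interpolation (s : Finset V) (l : V → ℤ) : Continuous (interpolation s l) :=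
  continuous_finsetSum _ fun v _ => (continuous_apply v).mul continuous_const

theorem exists_isLabelLift (hL : MGTriangle G L) (s : Simplex G) :
    ∃ l, IsLabelLift L s.1 l := by
  obtain ⟨c, hc⟩ : ∃ c, ∀ v ∈ s.1, L v ≠ c := by
    by_contra! h
    obtain ⟨u, hu, hu0⟩ := h 0
    obtain ⟨v, hv, hv1⟩ := h 1
    obtain ⟨w, hw, hw2⟩ := h 2
    have adj : ∀ a ∈ s.1, ∀ b ∈ s.1, L a ≠ L b → G.Adj a b := fun a ha b hb hab =>
      s.2.2.2 ha hb fun h => hab (h ▸ rfl)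
    exact hL u v w ⟨adj u hu v hv (by simp [hu0, hv1]), adj v hv w hw (by simp [hv1, hw2]),
      adj w hw u hu (by simp [hu0, hw2])⟩ (by rw [hu0, hv1, hw2])
  -- Cutting the circle at the missing label `c`, the labels `c + 1` and `c + 2` become
  -- consecutive integers.
  have h1 : ∀ a c : Fin 3, a ≠ c →
      (3 : ℤ) ∣ ((c + 1 : Fin 3) : ℕ) + ((a - c - 1 : Fin 3) : ℕ) - (a : ℕ) := by decide
  have h2 : ∀ a b c : Fin 3, a ≠ c → b ≠ c → (((c + 1 : Fin 3) : ℕ) + ((a - c - 1 : Fin 3) : ℕ) : ℤ)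
      - (((c + 1 : Fin 3) : ℕ) + ((b - c - 1 : Fin 3) : ℕ)) ≤ 1 := by decide
  exact ⟨fun v => ((c + 1 : Fin 3) : ℕ) + ((L v - c - 1 : Fin 3) : ℕ),
    fun v hv => h1 _ _ (hc v hv), fun u hu v hv => h2 _ _ _ (hc u hu) (hc v hv)⟩

/-- The interpolation of an integer lift of the labels is independent modulo `3` of the lift and of
the simplex containing the point: on the common vertices, two lifts differ by a constant. -/
theorem coe_interpolation_eq {s s' : Finset V} {l l' : V → ℤ} {y : V → ℝ}
    (hl : IsLabelLift L s l) (hl' : IsLabelLift L s' l')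
    (hy : y ∈ solidSimplex s) (hy' : y ∈ solidSimplex s') :
    (interpolation s l y : AddCircle (3 : ℝ)) = interpolation s' l' y := by
  classical
  have restrict : ∀ (f : V → ℝ), ∑ v ∈ s, y v * f v = ∑ v ∈ s ∩ s', y v * f v := fun f =>
    (Finset.sum_subset Finset.inter_subset_left fun v hv hv' => by
      rw [hy'.2.1 v fun h => hv' (Finset.mem_inter.2 ⟨hv, h⟩), zero_mul]).symm
  have restrict' : ∀ (f : V → ℝ), ∑ v ∈ s', y v * f v = ∑ v ∈ s ∩ s', y v * f v := fun f =>
    (Finset.sum_subset Finset.inter_subset_right fun v hv hv' => by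
      rw [hy.2.1 v fun h => hv' (Finset.mem_inter.2 ⟨h, hv⟩), zero_mul]).symm
  have one : ∑ v ∈ s ∩ s', y v = 1 := by simpa [hy.2.2] using (restrict fun _ => 1).symm
  obtain ⟨w, hw⟩ : (s ∩ s').Nonempty := by
    by_contra h
    rw [Finset.not_nonempty_iff_eq_empty.1 h] at one
    simp at one
  obtain ⟨hws, hws'⟩ := Finset.mem_inter.1 hw
  obtain ⟨m, hm⟩ : (3 : ℤ) ∣ l w - l' w := by
    have := hl.1 w hws
    have := hl'.1 w hws'
    lia
  have const : ∀ v ∈ s ∩ s', l v = l' v + 3 * m := fun v hv => by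
    obtain ⟨hs, hs'⟩ := Finset.mem_inter.1 hv
    have := hl.1 v hs
    have := hl'.1 v hs'
    have := hl.2 v hs w hws
    have := hl.2 w hws v hs
    have := hl'.2 v hs' w hws'
    have := hl'.2 w hws' v hs'
    lia
  have sum_eq : interpolation s l y = interpolation s' l' y + m • (3 : ℝ) := by
    rw [interpolation, interpolation, restrict, restrict', zsmul_eq_mul,
      ← mul_one ((m : ℝ) * 3), ← one, Finset.mul_sum, ← Finset.sum_add_distrib]
    refine Finset.sum_congr rfl fun v hv => ?_
    rw [const v hv]
    push_cast
    ring
  rw [sum_eq, AddCircle.coe_add, AddCircle.coe_zsmul, AddCircle.coe_period, smul_zero, add_zero]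

/-! ### The map from the triangle complex to the circle -/

/-- The continuous extension of the labeling, with values in `ℝ / 3ℤ`, to the triangle complex. -/
noncomputable def triangleMap (hL : MGTriangle G L) :
    C(TriangleComplex G, AddCircle (3 : ℝ)) where
  toFun := Quot.lift
    (fun p : SimplexPoint G =>
      (interpolation p.1.1 (exists_isLabelLift hL p.1).choose p.2 : AddCircle (3 : ℝ)))
    fun p q h => by
      have hq := q.2.2
      rw [← h] at hq
      simpa only [h] using coe_interpolation_eq (exists_isLabelLift hL p.1).choose_spec
        (exists_isLabelLift hL q.1).choose_spec p.2.2 hq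
  continuous_toFun := by
    refine continuous_quot_lift _ (continuous_sigma fun s => ?_)
    have h := (continuous_interpolation s.1 (exists_isLabelLift hL s).choose).comp
      (continuous_subtype_val (p := (· ∈ solidSimplex s.1)))
    exact (AddCircle.isCoveringMap_coe (3 : ℝ)).continuous.comp h

theorem triangleMap_mk (hL : MGTriangle G L) (p : SimplexPoint G) {l : V → ℤ}
    (hl : IsLabelLift L p.1.1 l) :
    triangleMap hL (Quot.mk _ p) = (interpolation p.1.1 l p.2 : AddCircle (3 : ℝ)) :=
  coe_interpolation_eq (exists_isLabelLift hL p.1).choose_spec hl p.2.2 p.2.2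

/-- On an edge, the map to the circle interpolates any two integer lifts of the labels of the ends
that differ by at most one. -/
theorem triangleMap_edgePoint (hL : MGTriangle G L) {u v : V} (h : G.Adj u v) {a b : ℤ}
    (ha : 3 ∣ a - (L u : ℕ)) (hb : 3 ∣ b - (L v : ℕ)) (hab : a - b ≤ 1) (hba : b - a ≤ 1)
    (t : unitInterval) :
    triangleMap hL (edgePoint h t) =
      (((1 - t) * a + t * b : ℝ) : AddCircle (3 : ℝ)) := by
  classical
  have huv := h.ne
  have hcell : (edgeCell h).1 = {u, v} := by ext; simp [edgeCell]
  have hl : IsLabelLift L (edgeCell h).1 fun w => if w = u then a else b := by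
    rw [hcell]
    constructor
    · simp [huv.symm, ha, hb]
    · simp only [Finset.mem_insert, Finset.mem_singleton]
      rintro _ (rfl | rfl) _ (rfl | rfl) <;> simp only [huv.symm, if_true, if_false] <;> lia
  rw [edgePoint, triangleMap_mk hL _ hl]
  simp only [interpolation]
  rw [hcell, Finset.sum_pair huv]
  simp [segmentCoord, huv, huv.symm]

open Classical in
/-- The vertex `v` as a point of the triangle complex. -/
noncomputable def vertexPoint (G : SimpleGraph V) (v : V) : TriangleComplex G :=
  Quot.mk _ ⟨⟨{v}, by simp, by simp, by simp⟩, ⟨Pi.single v 1, by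
    refine ⟨fun a => ?_, fun a ha => ?_, by simp⟩
    · rw [Pi.single_apply]
      split_ifs <;> simp
    · rw [Pi.single_eq_of_ne (by simpa using ha)]⟩⟩

theorem edgePoint_zero {u v : V} (h : G.Adj u v) : edgePoint h 0 = vertexPoint G u :=
  Quot.sound (by simp [segmentCoord])

theorem edgePoint_one {u v : V} (h : G.Adj u v) : edgePoint h 1 = vertexPoint G v :=
  Quot.sound (by simp [segmentCoord])

/-- The edge `uv` as a path in the triangle complex. -/
noncomputable def edgePath {u v : V} (h : G.Adj u v) :
    Path (vertexPoint G u) (vertexPoint G v) where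
  toFun := edgePoint h
  continuous_toFun := by
    refine continuous_quot_mk.comp (continuous_sigmaMk.comp (Continuous.subtype_mk ?_ _))
    unfold segmentCoord
    fun_prop
  source' := edgePoint_zero h
  target' := edgePoint_one h

theorem triangleMap_edgePath (hL : MGTriangle G L) {v u : V} (h : (labelDigraph G L).Adj v u)
    (t : unitInterval) :
    triangleMap hL (edgePath h.1 t) =
      triangleMap hL (vertexPoint G v) - ((t : ℝ) : AddCircle (3 : ℝ)) := by
  have hu : ∀ a b : Fin 3, a = b + 1 → (3 : ℤ) ∣ (a : ℕ) - 1 - (b : ℕ) := by decide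
  have formula := triangleMap_edgePoint hL h.1 (a := (L v : ℕ)) (b := (L v : ℕ) - 1) (by simp)
    (hu _ _ h.2) (by lia) (by lia)
  have start : triangleMap hL (vertexPoint G v) = _ := edgePoint_zero h.1 ▸ formula 0
  rw [start, ← AddCircle.coe_sub]
  refine (formula t).trans (congrArg _ ?_)
  push_cast
  simp
  ring

/-! ### The map from the triangle-square complex to the circle -/

/-- The labels of a square that obeys (MG□) lift to integers that change by at most one along each
side: a winding boundary would have three steps of the same sign and one step zero, and hence
all three labels and two adjacent corners with the same label. -/
theorem exists_squareLift (hS : MGSquare G L) (S : Square G) :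
    ∃ l : Fin 4 → ℤ, (∀ i, 3 ∣ l i - (L (S.corner i) : ℕ)) ∧
      ∀ i, l i - l (i + 1) ≤ 1 ∧ l (i + 1) - l i ≤ 1 := by
  have lift : ∀ a b c d : Fin 3, ((∀ e : Fin 3, e = a ∨ e = b ∨ e = c ∨ e = d) →
      a ≠ b ∧ b ≠ c ∧ c ≠ d ∧ d ≠ a) →
      ∃ i j k : Fin 3, let l : Fin 4 → ℤ := ![(a : ℕ), (a : ℕ) + (i : ℕ) - 1,
        (a : ℕ) + (i : ℕ) + (j : ℕ) - 2, (a : ℕ) + (k : ℕ) - 1]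
      (3 ∣ l 0 - (a : ℕ) ∧ 3 ∣ l 1 - (b : ℕ) ∧ 3 ∣ l 2 - (c : ℕ) ∧ 3 ∣ l 3 - (d : ℕ)) ∧
      ∀ i, l i - l (i + 1) ≤ 1 ∧ l (i + 1) - l i ≤ 1 := by
    decide
  have hq := S.isSquare
  obtain ⟨i, j, k, h, h'⟩ := lift (L (S.corner 0)) (L (S.corner 1)) (L (S.corner 2))
    (L (S.corner 3)) fun all => by
      have labels : ({L (S.corner 0), L (S.corner 1), L (S.corner 2), L (S.corner 3)} :
          Set (Fin 3)) = {0, 1, 2} := by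
        ext e
        have he : e = 0 ∨ e = 1 ∨ e = 2 := by revert e; decide
        exact iff_of_true (all e) he
      have rule := hS _ _ _ _ hq labels
      exact ⟨fun e => rule _ (by simp) _ (by simp) e hq.1,
        fun e => rule _ (by simp) _ (by simp) e hq.2.1,
        fun e => rule _ (by simp) _ (by simp) e hq.2.2.1,
        fun e => rule _ (by simp) _ (by simp) e hq.2.2.2.1⟩
  refine ⟨_, fun i => ?_, h'⟩
  fin_cases i
  exacts [h.1, h.2.1, h.2.2.1, h.2.2.2]

/-- The bilinear interpolation of the values `l` at the corners `(0,0)`, `(1,0)`, `(1,1)`, `(0,1)`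
of the unit square. -/
def bilinear (l : Fin 4 → ℤ) (p : unitInterval × unitInterval) : ℝ :=
  (1 - p.1) * (1 - p.2) * l 0 + p.1 * (1 - p.2) * l 1 + p.1 * p.2 * l 2 + (1 - p.1) * p.2 * l 3

theorem continuous_bilinear (l : Fin 4 → ℤ) : Continuous (bilinear l) := by
  unfold bilinear
  generalize (l 0 : ℝ) = a, (l 1 : ℝ) = b, (l 2 : ℝ) = c, (l 3 : ℝ) = d
  fun_prop

/-- The continuous extension of the labeling, with values in `ℝ / 3ℤ`, to the triangle-square
complex. -/
noncomputable def triangleSquareMap (hL : MGTriangle G L) (hS : MGSquare G L) :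
    C(TriangleSquareComplex G, AddCircle (3 : ℝ)) where
  toFun := Quot.lift
    (Sum.elim (triangleMap hL) fun p : Σ _ : Square G, unitInterval × unitInterval =>
      (bilinear (exists_squareLift hS p.1).choose p.2 : AddCircle (3 : ℝ)))
    fun p q h => by
      cases h with
      | bottom S t =>
        obtain ⟨hl, hd⟩ := (exists_squareLift hS S).choose_spec
        refine Eq.trans (congrArg ((↑) : ℝ → AddCircle (3 : ℝ)) ?_) (triangleMap_edgePoint hL _
          (hl 0) (hl 1) (hd 0).1 (hd 0).2 t).symm
        simp [bilinear]
      | right S t =>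
        obtain ⟨hl, hd⟩ := (exists_squareLift hS S).choose_spec
        refine Eq.trans (congrArg ((↑) : ℝ → AddCircle (3 : ℝ)) ?_) (triangleMap_edgePoint hL _
          (hl 1) (hl 2) (hd 1).1 (hd 1).2 t).symm
        simp [bilinear]
      | top S t =>
        obtain ⟨hl, hd⟩ := (exists_squareLift hS S).choose_spec
        refine Eq.trans (congrArg ((↑) : ℝ → AddCircle (3 : ℝ)) ?_) (triangleMap_edgePoint hL _
          (hl 3) (hl 2) (hd 2).2 (hd 2).1 t).symm
        simp [bilinear, add_comm]
      | left S t =>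
        obtain ⟨hl, hd⟩ := (exists_squareLift hS S).choose_spec
        refine Eq.trans (congrArg ((↑) : ℝ → AddCircle (3 : ℝ)) ?_) (triangleMap_edgePoint hL _
          (hl 0) (hl 3) (hd 3).2 (hd 3).1 t).symm
        simp [bilinear]
  continuous_toFun := by
    refine continuous_quot_lift _ (Continuous.sumElim (triangleMap hL).continuous
      (continuous_sigma fun S => ?_))
    have h := continuous_bilinear (exists_squareLift hS S).choose
    exact (AddCircle.isCoveringMap_coe (3 : ℝ)).continuous.comp h

/-- The inclusion of the triangle complex in the triangle-square complex. -/
def inclusion (G : SimpleGraph V) : C(TriangleComplex G, TriangleSquareComplex G) where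
  toFun x := Quot.mk _ (.inl x)
  continuous_toFun := continuous_quot_mk.comp continuous_inl

end TriSq

theorem mainTheorem5 {V : Type*} [Finite V] (G : SimpleGraph V) (L : V → Fin 3) :
    (SimplyConnectedSpace (TriSq.TriangleComplex G) → TriSq.MGTriangle G L →
      TriSq.IsAcyclic (TriSq.labelDigraph G L)) ∧
    (SimplyConnectedSpace (TriSq.TriangleSquareComplex G) → TriSq.MGTriangle G L →
      TriSq.MGSquare G L → TriSq.IsAcyclic (TriSq.labelDigraph G L)) := by
  refine ⟨fun _ hL => ?_, fun _ hL hS => ?_⟩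
  · exact TriSq.isAcyclic_of_simplyConnectedSpace _ (TriSq.vertexPoint G) (TriSq.triangleMap hL)
      fun v u h => ⟨TriSq.edgePath h.1, TriSq.triangleMap_edgePath hL h⟩
  · exact TriSq.isAcyclic_of_simplyConnectedSpace _
      (fun v => TriSq.inclusion G (TriSq.vertexPoint G v)) (TriSq.triangleSquareMap hL hS)
      fun v u h => ⟨(TriSq.edgePath h.1).map (TriSq.inclusion G).continuous,
        TriSq.triangleMap_edgePath hL h⟩
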